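/- A pseudo hoop is an algebra $(M;\odot,\to,\rightsquigarrow,1)$ of type $\langle 2,2,2,0\rangle$ such that for all $x,y,z\in M$: $x\odot 1=x=1\odot x$; $x\to x=1=x\rightsquigarrow x$; $(x\odot y)\to z=x\to(y\to z)$; $(x\odot y)\rightsquigarrow z=y\rightsquigarrow(x\rightsquigarrow z)$; and $(x\to y)\odot x=(y\to x)\odot y=x\odot(x\rightsquigarrow y)=y\odot(y\rightsquigarrow x)$. Put $x\le y$ iff $x\to y=1$, and $x^0=1$, $x^{n+1}=x^n\odot x$. The pseudo hoop is basic if $(x\to y)\to z\le((y\to x)\to z)\to z$ and $(x\rightsquigarrow y)\rightsquigarrow z\le((y\rightsquigarrow x)\rightsquigarrow z)\rightsquigarrow z$ for all $x,y,z\in M$. A filter is a nonempty subset of $M$ that is closed under $\odot$ and upward closed. A value of $g\in M\setminus\{1\}$ is a filter $V$ maximal with respect to $g\notin V$; its cover $V^*$ is the filter generated by $V\cup\{g\}$. The value $V$ is normal in $V^*$ if for all $x,y\in V^*$ one has $x\to y\in V$ iff $x\rightsquigarrow y\in V$. The algebra $M$ is normal-valued if every value is normal in its cover. **Corollary 6.9.**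 A basic pseudo hoop $M$ is normal-valued if and only if the following inequalities hold for all $x,y\in M$ and all $n\in\mathbb N$: (i) $x^2\odot y^2\le y\odot x$; (ii) $((x\to y)^n\rightsquigarrow y)^2\le (x\rightsquigarrow y)^{2n}\to y$; (iii) $((x\rightsquigarrow y)^n\to y)^2\le (x\to y)^{2n}\rightsquigarrow y$. Consequently, the defining equations of basic pseudo hoops together with (i)–(iii), where each inequality $s\le t$ is read as the equation $s\to t=1$, form a countable equational base for the variety of normal-valued basic pseudo hoops: an algebra of type $\langle 2,2,2,0\rangle$ satisfies all of these equations if and only if it is a normal-valued basic pseudo hoop. -/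

import Mathlib

universe u

/-- An algebra `(M; ⊙, →, ⇝, 1)` of type `⟨2, 2, 2, 0⟩`, with no laws imposed.
`x * y` is `x ⊙ y`, `x ⇾ y` is `x → y`, and `x ⇝ y` is `x ⇝ y`. -/
class HoopAlgebra (M : Type u) extends Mul M, One M where
  /-- the first implication `x → y` -/
  imp : M → M → M
  /-- the second implication `x ⇝ y` -/
  wimp : M → M → M

infixr:60 " ⇾ " => HoopAlgebra.imp
infixr:60 " ⇝ " => HoopAlgebra.wimp

section Algebra

variable {M : Type u} [HoopAlgebra M]

/-- `x ≤ y` iff `x → y = 1`. -/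
instance HoopAlgebra.instLE : LE M := ⟨fun x y => x ⇾ y = 1⟩

theorem HoopAlgebra.le_iff (x y : M) : x ≤ y ↔ x ⇾ y = 1 := Iff.rfl

/-- Powers: `x ^ 0 = 1` and `x ^ (n + 1) = x ^ n ⊙ x`. -/
instance HoopAlgebra.instPow : Pow M ℕ := ⟨fun x n => npowRec n x⟩

theorem HoopAlgebra.pow_zero' (x : M) : x ^ 0 = 1 := rfl

theorem HoopAlgebra.pow_succ' (x : M) (n : ℕ) : x ^ (n + 1) = x ^ n * x := rfl

end Algebra

/-- The laws of a pseudo hoop. -/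
class IsPseudoHoop (M : Type u) [HoopAlgebra M] : Prop where
  mul_one : ∀ x : M, x * 1 = x
  one_mul : ∀ x : M, 1 * x = x
  imp_self : ∀ x : M, x ⇾ x = 1
  wimp_self : ∀ x : M, x ⇝ x = 1
  mul_imp : ∀ x y z : M, (x * y) ⇾ z = x ⇾ (y ⇾ z)
  mul_wimp : ∀ x y z : M, (x * y) ⇝ z = y ⇝ (x ⇝ z)
  imp_mul_comm : ∀ x y : M, (x ⇾ y) * x = (y ⇾ x) * y
  imp_mul_eq_mul_wimp : ∀ x y : M, (y ⇾ x) * y = x * (x ⇝ y)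
  mul_wimp_comm : ∀ x y : M, x * (x ⇝ y) = y * (y ⇝ x)

/-- The laws of a basic pseudo hoop: those of a pseudo hoop together with (B1) and (B2). -/
class IsBasicPseudoHoop (M : Type u) [HoopAlgebra M] : Prop extends IsPseudoHoop M where
  basic_imp : ∀ x y z : M, ((x ⇾ y) ⇾ z) ≤ (((y ⇾ x) ⇾ z) ⇾ z)
  basic_wimp : ∀ x y z : M, ((x ⇝ y) ⇝ z) ≤ (((y ⇝ x) ⇝ z) ⇝ z)

section Filters

variable {M : Type u} [HoopAlgebra M]

/-- A filter: a nonempty subset closed under `⊙` and upward closed. -/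
structure IsHoopFilter (F : Set M) : Prop where
  nonempty : F.Nonempty
  mul_mem : ∀ x ∈ F, ∀ y ∈ F, x * y ∈ F
  mem_of_le : ∀ x ∈ F, ∀ y, x ≤ y → y ∈ F

/-- The filter generated by a subset: the intersection of all filters containing it. -/
def filterGenerated (S : Set M) : Set M :=
  ⋂₀ {F : Set M | IsHoopFilter F ∧ S ⊆ F}

/-- `V` is a value of `g ≠ 1`: a filter maximal with respect to not containing `g`. -/
structure IsValue (V : Set M) (g : M) : Prop where
  ne_one : g ≠ 1
  isFilter : IsHoopFilter V
  notMem : g ∉ V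
  maximal : ∀ F : Set M, IsHoopFilter F → g ∉ F → V ⊆ F → F = V

/-- The cover `V*` of a value `V` of `g`: the filter generated by `V` and `g`. -/
def valueCover (V : Set M) (g : M) : Set M := filterGenerated (insert g V)

/-- `V` is normal in `W`: for all `x, y ∈ W`, one has `x → y ∈ V` iff `x ⇝ y ∈ V`. -/
def IsNormalIn (V W : Set M) : Prop :=
  ∀ x ∈ W, ∀ y ∈ W, (x ⇾ y ∈ V ↔ x ⇝ y ∈ V)

end Filters

/-- Every value is normal in its cover. -/
def IsNormalValued (M : Type u) [HoopAlgebra M] : Prop :=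
  ∀ (g : M) (V : Set M), IsValue V g → IsNormalIn V (valueCover V g)

/-- The operation symbols of type `⟨2, 2, 2, 0⟩`. -/
inductive HoopOp : ℕ → Type
  | one : HoopOp 0
  | mul : HoopOp 2
  | imp : HoopOp 2
  | wimp : HoopOp 2

/-- The algebraic language with these operation symbols and no relation symbols. -/
def hoopLanguage : FirstOrder.Language := ⟨HoopOp, fun _ => Empty⟩

/-- The interpretation of the operation symbols in an algebra of this type. -/
instance hoopStructure (M : Type u) [HoopAlgebra M] : hoopLanguage.Structure M where
  funMap {n} f :=
    match n, f with
    | _, HoopOp.one => fun _ => (1 : M)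
    | _, HoopOp.mul => fun v => v 0 * v 1
    | _, HoopOp.imp => fun v => v 0 ⇾ v 1
    | _, HoopOp.wimp => fun v => v 0 ⇝ v 1
  RelMap r := nomatch r

/-- Terms over countably many variables. They form an algebra of the same type. -/
abbrev HoopTerm : Type := hoopLanguage.Term ℕ

instance HoopTerm.instHoopAlgebra : HoopAlgebra HoopTerm where
  one := FirstOrder.Language.Term.func (L := hoopLanguage) HoopOp.one ![]
  mul s t := FirstOrder.Language.Term.func (L := hoopLanguage) HoopOp.mul ![s, t]
  imp s t := FirstOrder.Language.Term.func (L := hoopLanguage) HoopOp.imp ![s, t]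
  wimp s t := FirstOrder.Language.Term.func (L := hoopLanguage) HoopOp.wimp ![s, t]

/-- The `i`-th variable, as a term. -/
def hoopVar (i : ℕ) : HoopTerm := FirstOrder.Language.Term.var i

/-- The algebra `M` satisfies the equation `e.1 = e.2` under every assignment of its variables. -/
def SatisfiesEquation (M : Type u) [HoopAlgebra M] (e : HoopTerm × HoopTerm) : Prop :=
  ∀ v : ℕ → M, e.1.realize v = e.2.realize v

/-- The equation `s → t = 1` that expresses the inequality `s ≤ t`. -/
def leEquation (s t : HoopTerm) : HoopTerm × HoopTerm := (s ⇾ t, 1)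

/-- The equations defining basic pseudo hoops, in the variables `x, y, z`. -/
def basicPseudoHoopEquations : Set (HoopTerm × HoopTerm) :=
  let x := hoopVar 0
  let y := hoopVar 1
  let z := hoopVar 2
  { (x * 1, x), (1 * x, x), (x ⇾ x, 1), (x ⇝ x, 1),
    ((x * y) ⇾ z, x ⇾ (y ⇾ z)),
    ((x * y) ⇝ z, y ⇝ (x ⇝ z)),
    ((x ⇾ y) * x, (y ⇾ x) * y),
    ((y ⇾ x) * y, x * (x ⇝ y)),
    (x * (x ⇝ y), y * (y ⇝ x)),
    leEquation ((x ⇾ y) ⇾ z) (((y ⇾ x) ⇾ z) ⇾ z),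
    leEquation ((x ⇝ y) ⇝ z) (((y ⇝ x) ⇝ z) ⇝ z) }

/-- The equations expressing the inequalities `x² ⊙ y² ≤ y ⊙ x` and, for every `n`,
`((x → y)ⁿ ⇝ y)² ≤ (x ⇝ y)²ⁿ → y` and `((x ⇝ y)ⁿ → y)² ≤ (x → y)²ⁿ ⇝ y`. -/
def normalValuedEquations : Set (HoopTerm × HoopTerm) :=
  let x := hoopVar 0
  let y := hoopVar 1
  {leEquation (x ^ 2 * y ^ 2) (y * x)} ∪
  Set.range (fun n : ℕ =>
    leEquation (((x ⇾ y) ^ n ⇝ y) ^ 2) ((x ⇝ y) ^ (2 * n) ⇾ y)) ∪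
  Set.range (fun n : ℕ =>
    leEquation (((x ⇝ y) ^ n ⇾ y) ^ 2) ((x ⇾ y) ^ (2 * n) ⇝ y))

/-!
A value `V` of a basic pseudo hoop `M` turns `M` into a chain under the preorder `x → y ∈ V`, which
multiplication from the right preserves (`IsValue.imp_mem_or_imp_mem`,
`IsHoopFilter.imp_mem_mul_right`), and an inequality holds in `M` as soon as it holds in each of
these chains (`IsPseudoHoop.le_of_forall_isValue`). If `W` is a value that is normal in its cover
`W*`, then `W*` modulo `W` is an archimedean chain, since there is no filter strictly between `W`
and `W*`; so it is commutative by an argument of Hölder (`mul_le_mul_swap_of_archimedean`,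
`IsValue.imp_mem_mul_swap`).

Let `M` be normal-valued. To check one of the inequalities modulo `V`, pass to a value `W ⊇ V` for
which all the elements concerned lie in `W*`. Commutativity gives the inequality modulo `W`
without the square, that is, up to a factor `w ∈ W`. The square absorbs `w`, because every element
outside `W` lies below `w` modulo `V` (`IsValue.imp_mem_of_notMem`). The third family of
inequalities is the second one for the opposite algebra.

Conversely, suppose `x → y ∈ V` but `b = x ⇝ y ∉ V`, where `x` and `y` lie in the cover of the value
`V`. By `x² ⊙ y² ≤ y ⊙ x` the filter generated by `V` and `b` consists of the elements above some
`v ⊙ bⁿ` with `v ∈ V`, and it contains the cover of `V`. Hence `bⁿ → y ∈ V` for some `n`, and the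
third family of inequalities yields `y ∈ V` and so `x ⇝ y ∈ V`
(`IsValue.wimp_mem_of_imp_mem`). Passing to the opposite algebra, the second family gives the
reverse implication.
-/

namespace IsPseudoHoop

/-! ### Order and residuation -/

section Order

variable {M : Type u} [HoopAlgebra M] [IsPseudoHoop M] {x y z t : M}

theorem le_refl (x : M) : x ≤ x := imp_self x

theorem le_antisymm (h : x ≤ y) (h' : y ≤ x) : x = y := by
  have e := imp_mul_comm x y
  rw [(HoopAlgebra.le_iff x y).1 h, (HoopAlgebra.le_iff y x).1 h', one_mul, one_mul] at e
  exact e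

/-- Associativity is not an axiom: both bracketings have the same residuals `· → w`. -/
theorem mul_assoc (x y z : M) : x * y * z = x * (y * z) := by
  apply le_antisymm
  · rw [HoopAlgebra.le_iff, mul_imp, mul_imp, ← mul_imp y z, ← mul_imp x, imp_self]
  · rw [HoopAlgebra.le_iff, mul_imp x, mul_imp y, ← mul_imp x y, ← mul_imp (x * y), imp_self]

theorem one_imp (x : M) : (1 : M) ⇾ x = x := by
  have idem : ∀ a b : M, 1 ⇾ (a ⇾ b) = a ⇾ b := fun a b => by rw [← mul_imp, one_mul]
  have hu : (x ⇾ 1) * x = 1 ⇾ x := by rw [imp_mul_comm, mul_one]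
  have hx : ((1 ⇾ x) ⇾ x) * (1 ⇾ x) = x := by
    rw [imp_mul_comm, ← mul_imp, mul_one, imp_self, one_mul]
  -- with `t = (1 → x) → x` and `e = x → 1` one has `t = e → 1`, and so `t * e = (1 → e) * 1 = e`
  have ht : (x ⇾ 1) ⇾ 1 = (1 ⇾ x) ⇾ x := by
    rw [← imp_self x, ← mul_imp, imp_self, hu]
  have hte : ((1 ⇾ x) ⇾ x) * (x ⇾ 1) = x ⇾ 1 := by
    rw [← ht, imp_mul_comm, idem, mul_one]
  calc (1 : M) ⇾ x = (x ⇾ 1) * x := hu.symm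
    _ = ((1 ⇾ x) ⇾ x) * (x ⇾ 1) * x := by rw [hte]
    _ = x := by rw [mul_assoc, hu, hx]

theorem le_one (x : M) : x ≤ 1 := by
  have hu : (x ⇾ 1) * x = 1 ⇾ x := by rw [imp_mul_comm, mul_one]
  have hu1 : (1 ⇾ x) ⇾ 1 = 1 := by rw [← hu, mul_imp, imp_self]
  rwa [one_imp] at hu1

theorem eq_one_of_one_le (h : 1 ≤ x) : x = 1 := le_antisymm (le_one x) h

theorem mul_le_iff : x * y ≤ z ↔ x ≤ y ⇾ z := by
  rw [HoopAlgebra.le_iff, HoopAlgebra.le_iff, mul_imp]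

theorem mul_le_right (x y : M) : x * y ≤ y := by
  rw [mul_le_iff, imp_self]; exact le_one x

theorem imp_mul_eq_of_le (h : x ≤ y) : (y ⇾ x) * y = x := by
  rw [imp_mul_comm, (HoopAlgebra.le_iff x y).1 h, one_mul]

theorem le_trans (h : x ≤ y) (h' : y ≤ z) : x ≤ z := by
  rw [← imp_mul_eq_of_le h, ← imp_mul_eq_of_le h', ← mul_assoc]
  exact mul_le_right _ _

theorem mul_le_mul_right (h : x ≤ y) (z : M) : x * z ≤ y * z :=
  mul_le_iff.2 (le_trans h (mul_le_iff.1 (le_refl _)))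

theorem imp_mul_le_right (x y : M) : (x ⇾ y) * x ≤ y := mul_le_iff.2 (le_refl _)

theorem pow_one (x : M) : x ^ 1 = x := by
  rw [HoopAlgebra.pow_succ', HoopAlgebra.pow_zero', one_mul]

theorem pow_two (x : M) : x ^ 2 = x * x := by
  rw [HoopAlgebra.pow_succ', pow_one]

theorem pow_add (x : M) (m n : ℕ) : x ^ (m + n) = x ^ m * x ^ n := by
  induction n with
  | zero => rw [Nat.add_zero, HoopAlgebra.pow_zero', mul_one]
  | succ n ih => rw [← Nat.add_assoc, HoopAlgebra.pow_succ', ih, mul_assoc,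
      HoopAlgebra.pow_succ']

theorem pow_two_mul (x : M) (n : ℕ) : x ^ (2 * n) = x ^ n * x ^ n := by
  rw [Nat.two_mul, pow_add]

end Order

end IsPseudoHoop

/-! ### The opposite algebra -/

/-- The opposite of an algebra of type `⟨2, 2, 2, 0⟩`: the same set with the product reversed and
the two implications exchanged. Elements and subsets of `M` are used as elements and subsets of
`OppositeHoop M` without a coercion. -/
def OppositeHoop (M : Type u) : Type u := M

namespace OppositeHoop

variable {M : Type u} [HoopAlgebra M]

instance : HoopAlgebra (OppositeHoop M) where
  mul x y := @HMul.hMul M M M _ y x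
  one := (1 : M)
  imp := @HoopAlgebra.wimp M _
  wimp := @HoopAlgebra.imp M _

instance [h : IsPseudoHoop M] : IsPseudoHoop (OppositeHoop M) where
  mul_one := h.one_mul
  one_mul := h.mul_one
  imp_self := h.wimp_self
  wimp_self := h.imp_self
  mul_imp x y z := h.mul_wimp y x z
  mul_wimp x y z := h.mul_imp y x z
  imp_mul_comm := h.mul_wimp_comm
  imp_mul_eq_mul_wimp x y := (h.imp_mul_eq_mul_wimp y x).symm
  mul_wimp_comm := h.imp_mul_comm

end OppositeHoop

namespace IsPseudoHoop

section Order

variable {M : Type u} [HoopAlgebra M] [IsPseudoHoop M] {x y z t : M}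

theorem mul_wimp_eq (x y : M) : x * (x ⇝ y) = (x ⇾ y) * x := by
  rw [imp_mul_comm, imp_mul_eq_mul_wimp]

theorem wimp_one (x : M) : x ⇝ 1 = 1 := le_one (M := OppositeHoop M) x

/-- The two implications define the same order. -/
theorem le_iff_wimp : x ≤ y ↔ x ⇝ y = 1 := by
  constructor
  · intro h
    have e : x = y * (y ⇝ x) := by
      rw [mul_wimp_eq, imp_mul_eq_of_le h]
    rw [e, mul_wimp, wimp_self, wimp_one]
  · intro h
    have e : (y ⇾ x) * y = x := by rw [imp_mul_eq_mul_wimp, h, mul_one]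
    rw [← e]
    exact mul_le_right _ _

theorem mul_le_iff' : x * y ≤ z ↔ y ≤ x ⇝ z := by
  rw [le_iff_wimp, le_iff_wimp, mul_wimp]

theorem mul_le_left (x y : M) : x * y ≤ x :=
  le_iff_wimp.2 (mul_le_right (M := OppositeHoop M) y x)

theorem mul_le_mul_left (h : x ≤ y) (z : M) : z * x ≤ z * y :=
  mul_le_iff'.2 (le_trans h (mul_le_iff'.1 (le_refl _)))

theorem mul_le_mul (h : x ≤ y) (h' : z ≤ t) : x * z ≤ y * t :=
  le_trans (mul_le_mul_right h z) (mul_le_mul_left h' y)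

theorem mul_wimp_le (x y : M) : x * (x ⇝ y) ≤ y := mul_le_iff'.2 (le_refl _)

theorem le_imp (x y : M) : y ≤ x ⇾ y := mul_le_iff.1 (mul_le_left y x)

theorem le_wimp (x y : M) : y ≤ x ⇝ y := mul_le_iff'.1 (mul_le_right x y)

end Order

end IsPseudoHoop

namespace OppositeHoop

variable {M : Type u} [HoopAlgebra M]

theorem le_iff [IsPseudoHoop M] {x y : M} : @LE.le (OppositeHoop M) _ x y ↔ x ≤ y :=
  (IsPseudoHoop.le_iff_wimp (M := M) (x := x) (y := y)).symm

theorem pow_eq [IsPseudoHoop M] (x : M) (n : ℕ) :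
    @HPow.hPow (OppositeHoop M) ℕ (OppositeHoop M) _ x n = x ^ n := by
  induction n with
  | zero => rfl
  | succ n ih =>
    have h : x * x ^ n = x ^ (n + 1) := by
      rw [Nat.add_comm n 1, IsPseudoHoop.pow_add, IsPseudoHoop.pow_one]
    exact (congrArg (fun t : M => x * t) ih).trans h

/-- The shape of the left-hand sides of the inequalities for `⇾` and `⇝`, transferred from the
opposite algebra. -/
theorem sq_apply_pow_eq [IsPseudoHoop M] (f : M → M) (x : M) (n : ℕ) :
    @HPow.hPow (OppositeHoop M) ℕ (OppositeHoop M) _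
      (f (@HPow.hPow (OppositeHoop M) ℕ (OppositeHoop M) _ x n)) 2 = f (x ^ n) ^ 2 :=
  (pow_eq (M := M) _ 2).trans (congrArg (fun s : M => f s ^ 2) (pow_eq x n))

instance [h : IsBasicPseudoHoop M] : IsBasicPseudoHoop (OppositeHoop M) where
  basic_imp x y z := (le_iff (M := M)).2 (h.basic_wimp x y z)
  basic_wimp x y z := (le_iff (M := M)).2 (h.basic_imp x y z)

theorem isHoopFilter_iff [IsPseudoHoop M] {F : Set M} :
    IsHoopFilter (M := OppositeHoop M) F ↔ IsHoopFilter F :=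
  ⟨fun h => ⟨h.1, fun x hx y hy => h.2 y hy x hx, fun x hx y hy => h.3 x hx y ((le_iff (M := M)).2 hy)⟩,
    fun h => ⟨h.1, fun x hx y hy => h.2 y hy x hx, fun x hx y hy => h.3 x hx y ((le_iff (M := M)).1 hy)⟩⟩

theorem isValue_iff [IsPseudoHoop M] {V : Set M} {g : M} :
    IsValue (M := OppositeHoop M) V g ↔ IsValue V g :=
  ⟨fun h => ⟨h.1, (isHoopFilter_iff (M := M)).1 h.2, h.3, fun F hF => h.4 F ((isHoopFilter_iff (M := M)).2 hF)⟩,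
    fun h => ⟨h.1, (isHoopFilter_iff (M := M)).2 h.2, h.3, fun F hF => h.4 F ((isHoopFilter_iff (M := M)).1 hF)⟩⟩

theorem valueCover_eq [IsPseudoHoop M] (V : Set M) (g : M) :
    valueCover (M := OppositeHoop M) V g = valueCover V g :=
  congrArg (Set.sInter (α := M)) (Set.ext fun _ => and_congr_left' (isHoopFilter_iff (M := M)))

theorem isNormalValued [IsPseudoHoop M] (h : IsNormalValued M) :
    IsNormalValued (OppositeHoop M) := by
  intro g V hV x hx y hy
  have e := valueCover_eq (M := M) V g
  exact (h g V ((isValue_iff (M := M)).1 hV) x (e ▸ hx) y (e ▸ hy)).symm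

end OppositeHoop

/-! ### Filters and values -/

namespace IsHoopFilter

variable {M : Type u} [HoopAlgebra M] [IsPseudoHoop M] {F : Set M} {x y z : M}

open IsPseudoHoop

theorem one_mem (hF : IsHoopFilter F) : (1 : M) ∈ F :=
  let ⟨x, hx⟩ := hF.nonempty
  hF.mem_of_le x hx 1 (le_one x)

theorem pow_mem (hF : IsHoopFilter F) (hx : x ∈ F) (n : ℕ) : x ^ n ∈ F := by
  induction n with
  | zero => exact hF.one_mem
  | succ n ih => exact hF.mul_mem _ ih _ hx

theorem mem_of_imp_mem (hF : IsHoopFilter F) (h : x ⇾ y ∈ F) (hx : x ∈ F) : y ∈ F :=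
  hF.mem_of_le _ (hF.mul_mem _ h _ hx) _ (imp_mul_le_right x y)

theorem mem_of_wimp_mem (hF : IsHoopFilter F) (h : x ⇝ y ∈ F) (hx : x ∈ F) : y ∈ F :=
  hF.mem_of_le _ (hF.mul_mem _ hx _ h) _ (mul_wimp_le x y)

theorem imp_mem_of_mul_le (hF : IsHoopFilter F) (hz : z ∈ F) (h : z * x ≤ y) : x ⇾ y ∈ F :=
  hF.mem_of_le z hz _ (mul_le_iff.1 h)

theorem wimp_mem_of_mul_le (hF : IsHoopFilter F) (hz : z ∈ F) (h : x * z ≤ y) : x ⇝ y ∈ F :=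
  hF.mem_of_le z hz _ (mul_le_iff'.1 h)

/-! For a filter `F`, the relation `x ⇾ y ∈ F` is the preorder on `M` whose classes are the right
cosets of `F`; multiplication from the right preserves it. -/

theorem imp_mem_of_le (hF : IsHoopFilter F) (h : x ≤ y) : x ⇾ y ∈ F := by
  rw [(HoopAlgebra.le_iff x y).1 h]; exact hF.one_mem

theorem imp_mem_trans (hF : IsHoopFilter F) (h : x ⇾ y ∈ F) (h' : y ⇾ z ∈ F) : x ⇾ z ∈ F := by
  refine hF.imp_mem_of_mul_le (hF.mul_mem _ h' _ h) ?_
  rw [IsPseudoHoop.mul_assoc]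
  exact le_trans (mul_le_mul_left (imp_mul_le_right x y) _) (imp_mul_le_right y z)

theorem imp_mem_mul_right (hF : IsHoopFilter F) (h : x ⇾ y ∈ F) (z : M) :
    (x * z) ⇾ (y * z) ∈ F := by
  refine hF.imp_mem_of_mul_le h ?_
  rw [← IsPseudoHoop.mul_assoc]
  exact mul_le_mul_right (imp_mul_le_right x y) z

theorem wimp_mem_mul_left (hF : IsHoopFilter F) (h : x ⇝ y ∈ F) (z : M) :
    (z * x) ⇝ (z * y) ∈ F := by
  refine hF.wimp_mem_of_mul_le h ?_
  rw [IsPseudoHoop.mul_assoc]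
  exact mul_le_mul_left (mul_wimp_le x y) z

/-- If two elements have no common upper bound outside `F`, then each may be replaced by any
element of the filter that it generates together with `F`. -/
theorem forall_common_upper_bound (hF : IsHoopFilter F) (q : M) :
    IsHoopFilter {u : M | ∀ g, u ≤ g → q ≤ g → g ∈ F} where
  nonempty := ⟨1, fun g hg _ => eq_one_of_one_le hg ▸ hF.one_mem⟩
  mul_mem u hu u' hu' g hg hq := by
    have h1 : u' ⇾ g ∈ F := hu _ (mul_le_iff.1 hg) (le_trans hq (le_imp _ _))
    have h2 : (u' ⇾ g) ⇝ g ∈ F :=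
      hu' _ (mul_le_iff'.1 (imp_mul_le_right _ _)) (le_trans hq (le_wimp _ _))
    exact hF.mem_of_wimp_mem h2 h1
  mem_of_le u hu u' h g hg hq := hu g (le_trans h hg) hq

theorem subset_forall_common_upper_bound {N : Type u} [HoopAlgebra N] {F : Set N} (hF : IsHoopFilter F) (q : N) :
    F ⊆ {u : N | ∀ g, u ≤ g → q ≤ g → g ∈ F} :=
  fun u hu g hg _ => hF.mem_of_le u hu g hg

theorem exists_isValue (hF : IsHoopFilter F) {g : M} (hg : g ∉ F) :
    ∃ V, F ⊆ V ∧ IsValue V g := by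
  obtain ⟨V, hFV, hV⟩ := zorn_subset_nonempty {G : Set M | IsHoopFilter G ∧ g ∉ G}
    (fun c hc hchain hne => by
      refine ⟨⋃₀ c, ⟨⟨?_, ?_, ?_⟩, ?_⟩, fun s hs => Set.subset_sUnion_of_mem hs⟩
      · obtain ⟨G, hG⟩ := hne
        exact ⟨1, G, hG, (hc hG).1.one_mem⟩
      · rintro x ⟨G, hG, hx⟩ y ⟨H, hH, hy⟩
        rcases hchain.total hG hH with h | h
        · exact ⟨H, hH, (hc hH).1.mul_mem _ (h hx) _ hy⟩
        · exact ⟨G, hG, (hc hG).1.mul_mem _ hx _ (h hy)⟩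
      · rintro x ⟨G, hG, hx⟩ y hxy
        exact ⟨G, hG, (hc hG).1.mem_of_le x hx y hxy⟩
      · rintro ⟨G, hG, hx⟩
        exact (hc hG).2 hx) F ⟨hF, hg⟩
  refine ⟨V, hFV, fun h => hg (h ▸ hF.one_mem), hV.prop.1, hV.prop.2, fun G hG hgG hVG => ?_⟩
  exact (hV.eq_of_subset ⟨hG, hgG⟩ hVG).symm

end IsHoopFilter

namespace IsPseudoHoop

variable {M : Type u} [HoopAlgebra M] [IsPseudoHoop M]

theorem isHoopFilter_singleton_one : IsHoopFilter ({1} : Set M) where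
  nonempty := ⟨1, rfl⟩
  mul_mem := by rintro _ rfl _ rfl; exact IsPseudoHoop.mul_one 1
  mem_of_le := by rintro _ rfl y hy; exact eq_one_of_one_le hy

/-- An inequality holds as soon as it holds modulo every value. -/
theorem le_of_forall_isValue {a b : M} (h : ∀ (V : Set M) (g : M), IsValue V g → a ⇾ b ∈ V) :
    a ≤ b := by
  by_contra hab
  obtain ⟨V, -, hV⟩ := isHoopFilter_singleton_one.exists_isValue (g := a ⇾ b) hab
  exact hV.notMem (h V _ hV)

theorem isHoopFilter_valueCover (V : Set M) (g : M) : IsHoopFilter (valueCover V g) where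
  nonempty := ⟨1, fun _ hF => hF.1.one_mem⟩
  mul_mem x hx y hy F hF := hF.1.mul_mem x (hx F hF) y (hy F hF)
  mem_of_le x hx y hxy F hF := hF.1.mem_of_le x (hx F hF) y hxy

end IsPseudoHoop

namespace IsValue

open IsPseudoHoop

variable {M : Type u} [HoopAlgebra M] {V F : Set M} {g x y : M}

theorem subset_valueCover : V ⊆ valueCover V g :=
  fun _ hx _ hF => hF.2 (Set.mem_insert_of_mem _ hx)

theorem mem_valueCover : g ∈ valueCover V g := fun _ hF => hF.2 (Set.mem_insert _ _)

/-- A filter that properly contains a value contains its cover. -/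
theorem valueCover_subset (hV : IsValue V g) (hF : IsHoopFilter F) (hVF : V ⊆ F) (hx : x ∈ F)
    (hxV : x ∉ V) : valueCover V g ⊆ F := by
  have hg : g ∈ F := by
    by_contra hg
    exact hxV (hV.maximal F hF hg hVF ▸ hx)
  exact fun z hz => hz F ⟨hF, Set.insert_subset hg hVF⟩

/-- Values are prime, because the law `basic_imp` of basic pseudo hoops says that `x ⇾ y` and
`y ⇾ x` have no common upper bound except `1`. -/
theorem imp_mem_or_imp_mem [IsBasicPseudoHoop M] (hV : IsValue V g) (x y : M) :
    x ⇾ y ∈ V ∨ y ⇾ x ∈ V := by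
  by_contra! h
  have hF := hV.isFilter
  have h0 : ∀ z, (x ⇾ y) ≤ z → (y ⇾ x) ≤ z → z ∈ V := fun z h1 h2 => by
    have := IsBasicPseudoHoop.basic_imp x y z
    rw [(HoopAlgebra.le_iff _ _).1 h1, (HoopAlgebra.le_iff _ _).1 h2, one_imp] at this
    exact eq_one_of_one_le this ▸ hF.one_mem
  have h1 : g ∈ {u : M | ∀ z, u ≤ z → (y ⇾ x) ≤ z → z ∈ V} :=
    hV.valueCover_subset (hF.forall_common_upper_bound _)
      (hF.subset_forall_common_upper_bound _) h0 h.1 mem_valueCover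
  have h2 : g ∈ {u : M | ∀ z, u ≤ z → g ≤ z → z ∈ V} :=
    hV.valueCover_subset (hF.forall_common_upper_bound _)
      (hF.subset_forall_common_upper_bound _) (fun z h3 h4 => h1 z h4 h3) h.2 mem_valueCover
  exact hV.notMem (h2 g (le_refl g) (le_refl g))

/-- Modulo a value `V`, every element outside a filter `F ⊇ V` lies below every element of `F`. -/
theorem imp_mem_of_notMem [IsBasicPseudoHoop M] (hV : IsValue V g) (hF : IsHoopFilter F)
    (hVF : V ⊆ F) (hx : x ∉ F) (hy : y ∈ F) : x ⇾ y ∈ V :=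
  (hV.imp_mem_or_imp_mem x y).resolve_right fun h => hx (hF.mem_of_imp_mem (hVF h) hy)

end IsValue

/-! ### Archimedean residuated chains are commutative -/

section Archimedean

variable {Q : Type*} [Monoid Q] [Preorder Q]

theorem exists_pow_le_le_pow (total : ∀ a b : Q, a ≤ b ∨ b ≤ a) (le_one : ∀ a : Q, a ≤ 1) {z : Q}
    (arch : ∀ b : Q, ∃ n : ℕ, z ^ n ≤ b) (x : Q) : ∃ m : ℕ, z ^ (m + 1) ≤ x ∧ x ≤ z ^ m := by
  classical
  rcases hn : Nat.find (arch x) with _ | m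
  · have h := Nat.find_spec (arch x)
    rw [hn, pow_zero] at h
    exact ⟨0, (le_one _).trans h, by rw [pow_zero]; exact le_one x⟩
  · have h := Nat.find_spec (arch x)
    rw [hn] at h
    exact ⟨m, h, (total _ _).resolve_right (Nat.find_min (arch x) (by omega))⟩

/-- A form of Hölder's theorem: an archimedean totally preordered monoid with greatest element `1`
which is residuated on one side and divisible is commutative up to equivalence. -/
theorem mul_le_mul_swap_of_archimedean [MulLeftMono Q] [MulRightMono Q]
    (total : ∀ a b : Q, a ≤ b ∨ b ≤ a)
    (le_one : ∀ a : Q, a ≤ 1)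
    (res : ∀ a b : Q, ∃ r, (∀ t, t * a ≤ b → t ≤ r) ∧ r * a ≤ b ∧ (b ≤ a → b ≤ r * a))
    (arch : ∀ a : Q, ¬ 1 ≤ a → ∀ b, ∃ n : ℕ, a ^ n ≤ b) (x y : Q) : x * y ≤ y * x := by
  have sandwich : ∀ z : Q, ¬ 1 ≤ z → ∀ a, ∃ m : ℕ, z ^ (m + 1) ≤ a ∧ a ≤ z ^ m :=
    fun z hz => exists_pow_le_le_pow total le_one (arch z hz)
  by_cases hc : ∃ c : Q, ¬ 1 ≤ c ∧ ∀ t, ¬ 1 ≤ t → t ≤ c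
  · -- if there is a greatest element below `1`, then every element is one of its powers
    obtain ⟨c, hc1, hc⟩ := hc
    have key : ∀ a : Q, ∃ k : ℕ, a ≤ c ^ k ∧ c ^ k ≤ a := fun a => by
      obtain ⟨m, h1, h2⟩ := sandwich c hc1 a
      obtain ⟨r, -, h3, h4⟩ := res (c ^ m) a
      by_cases hr : 1 ≤ r
      · exact ⟨m, h2, by simpa using (mul_le_mul_left hr (c ^ m)).trans h3⟩
      · refine ⟨m + 1, (h4 h2).trans ?_, h1⟩
        rw [pow_succ']
        exact mul_le_mul_left (hc r hr) _
    obtain ⟨k, hk1, hk2⟩ := key x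
    obtain ⟨l, hl1, hl2⟩ := key y
    calc x * y ≤ c ^ k * c ^ l := mul_le_mul' hk1 hl1
      _ = c ^ l * c ^ k := by rw [← pow_add, ← pow_add, Nat.add_comm]
      _ ≤ y * x := mul_le_mul' hl2 hk2
  · -- otherwise `1` is a limit from below, so with `d = x * y → y * x` there are `e` and `z` with
    -- `d < e ≤ z * z`, while a sandwich of `x` and `y` between powers of `z` shows `e ≤ d`
    push Not at hc
    by_contra hxy
    obtain ⟨d, hd, hdle, -⟩ := res (x * y) (y * x)
    have hd1 : ¬ 1 ≤ d := fun h => hxy <| by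
      simpa using (mul_le_mul_left h (x * y)).trans hdle
    obtain ⟨e, he1, hed⟩ := hc d hd1
    obtain ⟨t, ht1, hte⟩ := hc e he1
    have het : e ≤ t := (total _ _).resolve_right hte
    obtain ⟨z, hz1, hez⟩ : ∃ z, ¬ 1 ≤ z ∧ e ≤ z * z := by
      rcases total e (t * t) with h | h
      · exact ⟨t, ht1, h⟩
      · -- `e` is equivalent to `r * t`, and `t * t ≤ e` forces `t ≤ r`
        obtain ⟨r, hr, h1, h2⟩ := res t e
        refine ⟨r, fun h3 => hte ?_, (h2 het).trans (mul_le_mul_right (hr t h) r)⟩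
        simpa using (mul_le_mul_left h3 t).trans h1
    obtain ⟨m, hm1, hm2⟩ := sandwich z hz1 x
    obtain ⟨n, hn1, hn2⟩ := sandwich z hz1 y
    refine hed (hd e ?_)
    calc e * (x * y) ≤ z * z * (z ^ m * z ^ n) := mul_le_mul' hez (mul_le_mul' hm2 hn2)
      _ = z ^ (n + 1) * z ^ (m + 1) := by
        rw [← pow_add, ← pow_two, ← pow_add, ← pow_add]
        congr 1
        omega
      _ ≤ y * x := mul_le_mul' hn1 hm1

end Archimedean

/-! ### Values that are normal in their cover -/

namespace IsValue

open IsPseudoHoop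

variable {M : Type u} [HoopAlgebra M] {W : Set M} {g a b x y z : M}

theorem imp_mem_mul_left [IsPseudoHoop M] (hW : IsValue W g) (hN : IsNormalIn W (valueCover W g))
    (hx : x ∈ valueCover W g) (hy : y ∈ valueCover W g) (hz : z ∈ valueCover W g)
    (h : x ⇾ y ∈ W) : (z * x) ⇾ (z * y) ∈ W :=
  have hC := isHoopFilter_valueCover W g
  (hN _ (hC.mul_mem _ hz _ hx) _ (hC.mul_mem _ hz _ hy)).2
    (hW.isFilter.wimp_mem_mul_left ((hN _ hx _ hy).1 h) z)

theorem imp_mem_mul [IsPseudoHoop M] (hW : IsValue W g) (hN : IsNormalIn W (valueCover W g))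
    (hb : b ∈ valueCover W g) (hx : x ∈ valueCover W g) (hy : y ∈ valueCover W g)
    (h : a ⇾ b ∈ W) (h' : x ⇾ y ∈ W) : (a * x) ⇾ (b * y) ∈ W :=
  hW.isFilter.imp_mem_trans (hW.isFilter.imp_mem_mul_right h x)
    (hW.imp_mem_mul_left hN hx hy hb h')

theorem imp_mem_pow [IsPseudoHoop M] (hW : IsValue W g) (hN : IsNormalIn W (valueCover W g))
    (ha : a ∈ valueCover W g) (hb : b ∈ valueCover W g) (h : a ⇾ b ∈ W) (n : ℕ) :
    a ^ n ⇾ b ^ n ∈ W := by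
  induction n with
  | zero => exact hW.isFilter.imp_mem_of_le (le_refl _)
  | succ n ih => exact hW.imp_mem_mul hN ((isHoopFilter_valueCover W g).pow_mem hb n) ha hb ih h

theorem exists_pow_imp_mem [IsPseudoHoop M] (hW : IsValue W g)
    (hN : IsNormalIn W (valueCover W g)) (ha : a ∈ valueCover W g) (haW : a ∉ W)
    (hb : b ∈ valueCover W g) : ∃ n : ℕ, a ^ n ⇾ b ∈ W := by
  have hC := isHoopFilter_valueCover W g
  have hF : IsHoopFilter {z | z ∈ valueCover W g ∧ ∃ n : ℕ, a ^ n ⇾ z ∈ W} := by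
    refine ⟨⟨1, hC.one_mem, 0, hW.isFilter.imp_mem_of_le (le_refl _)⟩, ?_, ?_⟩
    · rintro x ⟨hx, m, hm⟩ y ⟨hy, n, hn⟩
      refine ⟨hC.mul_mem x hx y hy, m + n, ?_⟩
      rw [IsPseudoHoop.pow_add]
      exact hW.imp_mem_mul hN hx (hC.pow_mem ha n) hy hm hn
    · rintro x ⟨hx, m, hm⟩ y hxy
      exact ⟨hC.mem_of_le x hx y hxy, m,
        hW.isFilter.imp_mem_trans hm (hW.isFilter.imp_mem_of_le hxy)⟩
  have haF : a ∈ {z | z ∈ valueCover W g ∧ ∃ n : ℕ, a ^ n ⇾ z ∈ W} :=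
    ⟨ha, 1, hW.isFilter.imp_mem_of_le (by rw [IsPseudoHoop.pow_one]; exact le_refl a)⟩
  refine (hW.valueCover_subset hF (fun w hw => ⟨subset_valueCover hw, 0, ?_⟩) haF haW hb).2
  exact hW.isFilter.imp_mem_of_mul_le hw (mul_le_left w _)

/-- If a value `W` is normal in its cover `W*`, then `W*` is commutative modulo `W`: it is an
archimedean chain because there is no filter strictly between `W` and `W*`. -/
theorem imp_mem_mul_swap [IsBasicPseudoHoop M] (hW : IsValue W g)
    (hN : IsNormalIn W (valueCover W g)) (hx : x ∈ valueCover W g) (hy : y ∈ valueCover W g) :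
    (x * y) ⇾ (y * x) ∈ W := by
  have hF := hW.isFilter
  have hC := isHoopFilter_valueCover W g
  let _ : Monoid (valueCover W g) :=
    { mul := fun a b => ⟨a.1 * b.1, hC.mul_mem _ a.2 _ b.2⟩
      one := ⟨1, hC.one_mem⟩
      mul_assoc := fun a b c => Subtype.ext (IsPseudoHoop.mul_assoc a.1 b.1 c.1)
      one_mul := fun a => Subtype.ext (IsPseudoHoop.one_mul a.1)
      mul_one := fun a => Subtype.ext (IsPseudoHoop.mul_one a.1)
      npow := fun n a => ⟨a.1 ^ n, hC.pow_mem a.2 n⟩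
      npow_zero := fun _ => rfl
      npow_succ := fun _ _ => rfl }
  let P : Preorder (valueCover W g) :=
    { le := fun a b => a.1 ⇾ b.1 ∈ W
      le_refl := fun a => hF.imp_mem_of_le (IsPseudoHoop.le_refl a.1)
      le_trans := fun _ _ _ h h' => hF.imp_mem_trans h h' }
  -- `P` is named because the subtype also inherits the order of `M`, which is not the one meant
  have : @MulLeftMono (valueCover W g) _ P.toLE :=
    ⟨fun c a b h => hW.imp_mem_mul_left hN a.2 b.2 c.2 h⟩
  have : @MulRightMono (valueCover W g) _ P.toLE := ⟨fun c _ _ h => hF.imp_mem_mul_right h c.1⟩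
  have one_le : ∀ a : valueCover W g, P.le 1 a ↔ a.1 ∈ W := fun a => by
    change (1 : M) ⇾ a.1 ∈ W ↔ _
    rw [one_imp]
  refine mul_le_mul_swap_of_archimedean (Q := valueCover W g)
    (fun a b => hW.imp_mem_or_imp_mem a.1 b.1) (fun a => hF.imp_mem_of_le (IsPseudoHoop.le_one a.1))
    (fun a b => ⟨⟨a.1 ⇾ b.1, hC.mem_of_le _ b.2 _ (IsPseudoHoop.le_imp a.1 b.1)⟩, ?_, ?_, ?_⟩)
    (fun a ha b => hW.exists_pow_imp_mem hN a.2 (fun h => ha ((one_le a).2 h)) b.2)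
    ⟨x, hx⟩ ⟨y, hy⟩
  · intro t ht
    change t.1 ⇾ (a.1 ⇾ b.1) ∈ W
    rw [← mul_imp]
    exact ht
  · exact hF.imp_mem_of_le (imp_mul_le_right a.1 b.1)
  · intro h
    change b.1 ⇾ ((a.1 ⇾ b.1) * a.1) ∈ W
    rw [imp_mul_comm]
    exact hF.imp_mem_of_mul_le h (IsPseudoHoop.le_refl _)

end IsValue

/-! ### Inequalities in normal-valued algebras -/

namespace IsNormalValued

open IsPseudoHoop

variable {M : Type u} [HoopAlgebra M] [IsBasicPseudoHoop M]

theorem sq_mul_sq_le (hM : IsNormalValued M) (x y : M) : x ^ 2 * y ^ 2 ≤ y * x := by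
  refine le_of_forall_isValue fun V g hV => ?_
  have hF := hV.isFilter
  rw [IsPseudoHoop.pow_two, IsPseudoHoop.pow_two]
  by_cases hxy : x * y ∈ V
  · have hx := hF.mem_of_le _ hxy _ (mul_le_left x y)
    have hy := hF.mem_of_le _ hxy _ (mul_le_right x y)
    exact hF.mem_of_le _ (hF.mul_mem _ hy _ hx) _ (IsPseudoHoop.le_imp _ _)
  obtain ⟨W, hVW, hW⟩ := hF.exists_isValue hxy
  have hN := hM _ W hW
  have hG := hW.isFilter
  have hC := isHoopFilter_valueCover W (x * y)
  have hx : x ∈ valueCover W (x * y) := hC.mem_of_le _ IsValue.mem_valueCover _ (mul_le_left x y)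
  have hy : y ∈ valueCover W (x * y) := hC.mem_of_le _ IsValue.mem_valueCover _ (mul_le_right x y)
  by_cases hxW : x ∈ W
  · -- here `y * x = w * y` with `w ∈ W`, and `y` lies below `w` modulo `V`
    have hyW : y ∉ W := fun h => hW.notMem (hG.mul_mem _ hxW _ h)
    have hw : y ⇾ (y * x) ∈ W := (hN _ hy _ (hC.mul_mem _ hy _ hx)).2
      (hG.wimp_mem_of_mul_le hxW (IsPseudoHoop.le_refl _))
    have h := hF.imp_mem_mul_right (hV.imp_mem_of_notMem hG hVW hyW hw) y
    exact hF.imp_mem_trans (hF.imp_mem_of_le (mul_le_right _ _))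
      (hF.imp_mem_trans h (hF.imp_mem_of_le (imp_mul_le_right _ _)))
  · -- here `w * (x * y) ≤ y * x` with `w ∈ W`, and `x` lies below `w` modulo `V`
    have hw := hW.imp_mem_mul_swap hN hx hy
    have h := hF.imp_mem_mul_right (hV.imp_mem_of_notMem hG hVW hxW hw) (x * y)
    refine hF.imp_mem_trans (hF.imp_mem_of_le ?_)
      (hF.imp_mem_trans h (hF.imp_mem_of_le (imp_mul_le_right _ _)))
    rw [← IsPseudoHoop.mul_assoc, ← IsPseudoHoop.mul_assoc]
    exact mul_le_left _ _

/-- For a value `V` not containing `y` and the value `W ⊇ V` of `y`, the elements `a = x ⇾ y` and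
`b = x ⇝ y` satisfy `b ≤ a` modulo `W`, and `c = aⁿ ⇝ y` is the largest element with
`aⁿ ⊙ c ≤ y`. -/
theorem imp_pow_wimp_sq_le (hM : IsNormalValued M) (n : ℕ) (x y : M) :
    ((x ⇾ y) ^ n ⇝ y) ^ 2 ≤ (x ⇝ y) ^ (2 * n) ⇾ y := by
  rw [← mul_le_iff, IsPseudoHoop.pow_two, IsPseudoHoop.pow_two_mul]
  refine le_of_forall_isValue fun V g hV => ?_
  have hF := hV.isFilter
  have hac : (x ⇾ y) ^ n * ((x ⇾ y) ^ n ⇝ y) ≤ y := mul_wimp_le _ _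
  have hyc : y ≤ (x ⇾ y) ^ n ⇝ y := le_wimp _ _
  generalize (x ⇾ y) ^ n ⇝ y = c at hac hyc ⊢
  by_cases hyV : y ∈ V
  · exact hF.mem_of_le _ hyV _ (IsPseudoHoop.le_imp _ _)
  rcases hV.imp_mem_or_imp_mem x y with ha | hyx
  · -- `aⁿ ∈ V` and `aⁿ * c ≤ y` give `c ≤ y` modulo `V`
    refine hF.imp_mem_trans (hF.imp_mem_of_le ?_) (hF.imp_mem_of_mul_le (hF.pow_mem ha n) hac)
    exact IsPseudoHoop.le_trans (mul_le_left _ _) (mul_le_left _ _)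
  obtain ⟨W, hVW, hW⟩ := hF.exists_isValue hyV
  have hN := hM _ W hW
  have hG := hW.isFilter
  have hC := isHoopFilter_valueCover W y
  have hy : y ∈ valueCover W y := IsValue.mem_valueCover
  have hx : x ∈ valueCover W y := hC.mem_of_imp_mem (IsValue.subset_valueCover (hVW hyx)) hy
  have hc : c ∈ valueCover W y := hC.mem_of_le _ hy _ hyc
  have ha : x ⇾ y ∈ valueCover W y := hC.mem_of_le _ hy _ (IsPseudoHoop.le_imp x y)
  have hb : x ⇝ y ∈ valueCover W y := hC.mem_of_le _ hy _ (le_wimp x y)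
  have hba : (x ⇝ y) ⇾ (x ⇾ y) ∈ W := by
    rw [← mul_imp]
    exact hG.imp_mem_trans (hW.imp_mem_mul_swap hN hb hx) (hG.imp_mem_of_le (mul_wimp_le x y))
  have hban := hW.imp_mem_pow hN hb ha hba n
  have hw : (c * (x ⇝ y) ^ n) ⇾ ((x ⇾ y) ^ n * c) ∈ W :=
    hG.imp_mem_trans (hW.imp_mem_mul_swap hN hc (hC.pow_mem hb n)) (hG.imp_mem_mul_right hban c)
  by_cases hcW : c ∈ W
  · -- the first factor `bⁿ` of `bⁿ * bⁿ` lies below `w = bⁿ ⇾ aⁿ * c` modulo `V`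
    have hbW : (x ⇝ y) ^ n ∉ W := fun h =>
      hW.notMem (hG.mem_of_le _ (hG.mul_mem _ (hG.mem_of_imp_mem hban h) _ hcW) _ hac)
    have hw' : (x ⇝ y) ^ n ⇾ ((x ⇾ y) ^ n * c) ∈ W :=
      hG.imp_mem_trans (hG.imp_mem_of_mul_le hcW (IsPseudoHoop.le_refl _)) hw
    have h := hF.imp_mem_mul_right (hV.imp_mem_of_notMem hG hVW hbW hw') ((x ⇝ y) ^ n)
    exact hF.imp_mem_trans (hF.imp_mem_of_le (mul_le_right _ _)) (hF.imp_mem_trans h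
      (hF.imp_mem_of_le (IsPseudoHoop.le_trans (imp_mul_le_right _ _) hac)))
  · -- the first factor `c` of `c * (c * bⁿ)` lies below `w = c * bⁿ ⇾ aⁿ * c` modulo `V`
    have h := hF.imp_mem_mul_right (hV.imp_mem_of_notMem hG hVW hcW hw) (c * (x ⇝ y) ^ n)
    refine hF.imp_mem_trans (hF.imp_mem_of_le ?_) (hF.imp_mem_trans h
      (hF.imp_mem_of_le (IsPseudoHoop.le_trans (imp_mul_le_right _ _) hac)))
    rw [← IsPseudoHoop.mul_assoc, ← IsPseudoHoop.mul_assoc]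
    exact mul_le_left _ _

theorem wimp_pow_imp_sq_le (hM : IsNormalValued M) (n : ℕ) (x y : M) :
    ((x ⇝ y) ^ n ⇾ y) ^ 2 ≤ (x ⇾ y) ^ (2 * n) ⇝ y := by
  have h := (OppositeHoop.le_iff (M := M)).1
    (imp_pow_wimp_sq_le (OppositeHoop.isNormalValued hM) n x y)
  exact (congrArg₂ (fun s t : M => s ≤ t)
    (OppositeHoop.sq_apply_pow_eq (M := M) (fun s => s ⇾ y) (x ⇝ y) n)
    (congrArg (fun s : M => s ⇝ y) (OppositeHoop.pow_eq (M := M) (x ⇾ y) (2 * n)))).mp h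

end IsNormalValued

/-! ### Normality from the inequalities -/

namespace IsValue

open IsPseudoHoop

variable {M : Type u} [HoopAlgebra M] [IsPseudoHoop M] {V : Set M} {g x y : M}

theorem wimp_mem_of_imp_mem (hV : IsValue V g) (h1 : ∀ x y : M, x ^ 2 * y ^ 2 ≤ y * x)
    (h2 : ∀ (n : ℕ) (x y : M), ((x ⇝ y) ^ n ⇾ y) ^ 2 ≤ (x ⇾ y) ^ (2 * n) ⇝ y)
    (hy : y ∈ valueCover V g) (h : x ⇾ y ∈ V) : x ⇝ y ∈ V := by
  have hF := hV.isFilter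
  by_contra hb
  -- by `h1`, factors from `V` can be moved to the left in the filter generated by `V` and `x ⇝ y`
  have hE : IsHoopFilter {z | ∃ n : ℕ, (x ⇝ y) ^ n ⇾ z ∈ V} := by
    refine ⟨⟨1, 0, hF.imp_mem_of_le (IsPseudoHoop.le_refl _)⟩, ?_, ?_⟩
    · rintro s ⟨m, hm⟩ t ⟨n, hn⟩
      generalize x ⇝ y = b at hm hn
      refine ⟨2 * m + n, hF.imp_mem_of_mul_le
        (hF.mul_mem _ hm _ (hF.pow_mem hn 2)) ?_⟩
      generalize hv : b ^ m ⇾ s = v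
      generalize hw : b ^ n ⇾ t = w
      have e : v * w ^ 2 * b ^ (2 * m + n) = v * (w ^ 2 * (b ^ m) ^ 2) * b ^ n := by
        rw [IsPseudoHoop.pow_add, pow_two_mul, ← IsPseudoHoop.pow_two, IsPseudoHoop.mul_assoc,
          IsPseudoHoop.mul_assoc, IsPseudoHoop.mul_assoc]
      have e' : v * (b ^ m * w) * b ^ n = (v * b ^ m) * (w * b ^ n) := by
        rw [IsPseudoHoop.mul_assoc, IsPseudoHoop.mul_assoc, IsPseudoHoop.mul_assoc]
      rw [e]
      refine IsPseudoHoop.le_trans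
        (IsPseudoHoop.mul_le_mul_right (IsPseudoHoop.mul_le_mul_left (h1 w (b ^ m)) v) (b ^ n)) ?_
      rw [e', ← hv, ← hw]
      exact IsPseudoHoop.mul_le_mul (imp_mul_le_right _ _) (imp_mul_le_right _ _)
    · rintro s ⟨m, hm⟩ t hst
      exact ⟨m, hF.imp_mem_trans hm (hF.imp_mem_of_le hst)⟩
  obtain ⟨n, hn⟩ := hV.valueCover_subset hE
    (fun v hv => ⟨0, hF.imp_mem_of_mul_le hv (mul_le_left v _)⟩)
    ⟨1, hF.imp_mem_of_le (by rw [IsPseudoHoop.pow_one]; exact IsPseudoHoop.le_refl _)⟩ hb hy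
  have hyV : y ∈ V :=
    hF.mem_of_wimp_mem (hF.mem_of_le _ (hF.pow_mem hn 2) _ (h2 n x y)) (hF.pow_mem h (2 * n))
  exact hb (hF.mem_of_le y hyV _ (le_wimp x y))

end IsValue

theorem isNormalValued_of_le {M : Type u} [HoopAlgebra M] [IsPseudoHoop M]
    (h1 : ∀ x y : M, x ^ 2 * y ^ 2 ≤ y * x)
    (h2 : ∀ (n : ℕ) (x y : M), ((x ⇾ y) ^ n ⇝ y) ^ 2 ≤ (x ⇝ y) ^ (2 * n) ⇾ y)
    (h3 : ∀ (n : ℕ) (x y : M), ((x ⇝ y) ^ n ⇾ y) ^ 2 ≤ (x ⇾ y) ^ (2 * n) ⇝ y) :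
    IsNormalValued M := by
  intro g V hV x _ y hy
  refine ⟨hV.wimp_mem_of_imp_mem h1 h3 hy, fun h => ?_⟩
  refine IsValue.wimp_mem_of_imp_mem (M := OppositeHoop M) (V := V) (g := g) (x := x) (y := y)
    ((OppositeHoop.isValue_iff (M := M)).2 hV) (fun a b => ?_) (fun n a b => ?_)
    (by rw [OppositeHoop.valueCover_eq (M := M)]; exact hy) h
  · exact (OppositeHoop.le_iff (M := M)).2 ((congrArg₂ (fun s t : M => t * s ≤ @HMul.hMul M M M _ a b)
      (OppositeHoop.pow_eq (M := M) a 2) (OppositeHoop.pow_eq (M := M) b 2)).mpr (h1 b a))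
  · exact (OppositeHoop.le_iff (M := M)).2 ((congrArg₂ (fun s t : M => s ≤ t)
      (OppositeHoop.sq_apply_pow_eq (M := M) (fun s => s ⇝ b) (HoopAlgebra.imp (M := M) a b) n)
      (congrArg (fun s : M => s ⇾ b)
        (OppositeHoop.pow_eq (M := M) (HoopAlgebra.wimp (M := M) a b) (2 * n)))).mpr (h2 n a b))

/-! ### Equations -/

section Equations

variable {A : Type u} [HoopAlgebra A] (v : ℕ → A) (s t : HoopTerm)

theorem realize_hoopVar (i : ℕ) : (hoopVar i).realize v = v i := rfl

theorem realize_one : (1 : HoopTerm).realize v = 1 := rfl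

theorem realize_mul : (s * t).realize v = s.realize v * t.realize v := rfl

theorem realize_imp : (s ⇾ t).realize v = s.realize v ⇾ t.realize v := rfl

theorem realize_wimp : (s ⇝ t).realize v = s.realize v ⇝ t.realize v := rfl

theorem realize_pow (n : ℕ) : (s ^ n).realize v = s.realize v ^ n := by
  induction n with
  | zero => rfl
  | succ n ih => rw [HoopAlgebra.pow_succ', HoopAlgebra.pow_succ', realize_mul, ih]

end Equations

theorem satisfies_basicPseudoHoopEquations_iff {A : Type u} [HoopAlgebra A] :
    (∀ e ∈ basicPseudoHoopEquations, SatisfiesEquation A e) ↔ IsBasicPseudoHoop A := by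
  simp only [basicPseudoHoopEquations, Set.forall_mem_insert, Set.mem_singleton_iff, forall_eq,
    SatisfiesEquation, leEquation, realize_imp, realize_wimp, realize_mul, realize_one,
    realize_hoopVar]
  constructor
  · rintro ⟨h1, h2, h3, h4, h5, h6, h7, h8, h9, h10, h11⟩
    let v : A → A → A → ℕ → A := fun x y z i => if i = 0 then x else if i = 1 then y else z
    exact
      { mul_one := fun x => h1 (v x x x)
        one_mul := fun x => h2 (v x x x)
        imp_self := fun x => h3 (v x x x)
        wimp_self := fun x => h4 (v x x x)
        mul_imp := fun x y z => h5 (v x y z)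
        mul_wimp := fun x y z => h6 (v x y z)
        imp_mul_comm := fun x y => h7 (v x y y)
        imp_mul_eq_mul_wimp := fun x y => h8 (v x y y)
        mul_wimp_comm := fun x y => h9 (v x y y)
        basic_imp := fun x y z => h10 (v x y z)
        basic_wimp := fun x y z => h11 (v x y z) }
  · intro h
    exact ⟨fun _ => h.mul_one _, fun _ => h.one_mul _, fun _ => h.imp_self _,
      fun _ => h.wimp_self _, fun _ => h.mul_imp _ _ _, fun _ => h.mul_wimp _ _ _,
      fun _ => h.imp_mul_comm _ _, fun _ => h.imp_mul_eq_mul_wimp _ _,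
      fun _ => h.mul_wimp_comm _ _, fun _ => h.basic_imp _ _ _, fun _ => h.basic_wimp _ _ _⟩

theorem satisfies_normalValuedEquations_iff {A : Type u} [HoopAlgebra A] :
    (∀ e ∈ normalValuedEquations, SatisfiesEquation A e) ↔
      (∀ x y : A, x ^ 2 * y ^ 2 ≤ y * x) ∧
      (∀ (n : ℕ) (x y : A), ((x ⇾ y) ^ n ⇝ y) ^ 2 ≤ ((x ⇝ y) ^ (2 * n) ⇾ y)) ∧
      (∀ (n : ℕ) (x y : A), ((x ⇝ y) ^ n ⇾ y) ^ 2 ≤ ((x ⇾ y) ^ (2 * n) ⇝ y)) := by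
  simp only [normalValuedEquations, Set.mem_union, or_imp, forall_and, Set.forall_mem_range,
    Set.mem_singleton_iff, forall_eq, SatisfiesEquation, leEquation, realize_imp, realize_wimp,
    realize_mul, realize_one, realize_pow, realize_hoopVar, and_assoc, HoopAlgebra.le_iff]
  let v : A → A → ℕ → A := fun x y i => if i = 0 then x else y
  exact ⟨fun h => ⟨fun x y => h.1 (v x y), fun n x y => h.2.1 n (v x y),
    fun n x y => h.2.2 n (v x y)⟩,
    fun h => ⟨fun _ => h.1 _ _, fun n _ => h.2.1 n _ _, fun n _ => h.2.2 n _ _⟩⟩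

theorem corollary6p9 :
    (∀ (M : Type u) [HoopAlgebra M] [IsBasicPseudoHoop M],
      IsNormalValued M ↔
        (∀ x y : M, x ^ 2 * y ^ 2 ≤ y * x) ∧
        (∀ (n : ℕ) (x y : M), ((x ⇾ y) ^ n ⇝ y) ^ 2 ≤ ((x ⇝ y) ^ (2 * n) ⇾ y)) ∧
        (∀ (n : ℕ) (x y : M), ((x ⇝ y) ^ n ⇾ y) ^ 2 ≤ ((x ⇾ y) ^ (2 * n) ⇝ y))) ∧
    ((basicPseudoHoopEquations ∪ normalValuedEquations).Countable ∧
      ∀ (A : Type u) [HoopAlgebra A],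
        (∀ e ∈ basicPseudoHoopEquations ∪ normalValuedEquations, SatisfiesEquation A e) ↔
          IsBasicPseudoHoop A ∧ IsNormalValued A) := by
  have main : ∀ (M : Type u) [HoopAlgebra M] [IsBasicPseudoHoop M], IsNormalValued M ↔
      (∀ x y : M, x ^ 2 * y ^ 2 ≤ y * x) ∧
      (∀ (n : ℕ) (x y : M), ((x ⇾ y) ^ n ⇝ y) ^ 2 ≤ ((x ⇝ y) ^ (2 * n) ⇾ y)) ∧
      (∀ (n : ℕ) (x y : M), ((x ⇝ y) ^ n ⇾ y) ^ 2 ≤ ((x ⇾ y) ^ (2 * n) ⇝ y)) :=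
    fun M _ _ => ⟨fun h => ⟨h.sq_mul_sq_le, h.imp_pow_wimp_sq_le, h.wimp_pow_imp_sq_le⟩,
      fun h => isNormalValued_of_le h.1 h.2.1 h.2.2⟩
  refine ⟨main, ?_, fun A _ => ?_⟩
  · refine Set.Countable.union (Set.Finite.countable ?_) (((Set.countable_singleton _).union
      (Set.countable_range _)).union (Set.countable_range _))
    simp only [basicPseudoHoopEquations, Set.finite_insert, Set.finite_singleton]
  · simp only [Set.mem_union, or_imp, forall_and]
    rw [satisfies_basicPseudoHoopEquations_iff,
      satisfies_normalValuedEquations_iff]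
    exact and_congr_right fun h => (main A).symm
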